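/- Let $n\ge 0$, and let $K\subset\mathbb R^2$ be a closed round disc from which $n$ open round discs have been removed, whose closures are pairwise disjoint and contained in the interior of the large disc. (So $K$ is the compact connected planar surface of Euler characteristic $1-n$.) Let $\gamma_0,\dots,\gamma_n$ be any enumeration of the boundary curves of $K$, and let $\pi:\mathbb R^2\times\mathbb R\to\mathbb R^2$ be the projection. An $n$-turning weight is a tuple $W=(t_0,\dots,t_n)$ of odd integers with $\sum_{i=0}^n t_i=1-n$. A basis of $W$ is a tuple of integers $(k_0,\dots,k_n)$ with $t_0=1+2k_0$ and $t_i=-1+2k_i$ for $1\le i\le n$ (so necessarily $\sum_i k_i=0$). **Proposition.** For every $n$-turning weight $W$ and every basis $(k_0,\dots,k_n)$ of $W$ there is a smooth embedding $\varepsilon:K\to\mathbb R^2\times\mathbb R$ that is a geometric realization of $W$ respecting the basis. That is: 1. every interior point of $K$ is a regular point of $\pi\circ\varepsilon$, i.e. $d(\pi\circ\varepsilon)$ is surjective there; 2. $\pi\circ\varepsilon$ restricts to an immersion of each boundary curve into the plane, and the turning number of $\pi\circ\varepsilon(\gamma_i)$ is $t_0=1+2k_0$ for $i=0$ and $t_i=-1+2k_i$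 for $1\le i\le n$. Here $K$ is oriented by pulling back the orientation of $\mathbb R^2$ under $\pi\circ\varepsilon$, each $\gamma_i$ has the induced boundary orientation, and the turning number of a smooth regular closed plane curve is the total change, divided by $2\pi$, of a continuous angle function of its velocity over one period. -/

import Mathlib

open scoped ContDiff

/-- An `n`-turning weight: an `(n+1)`-tuple of odd integers with sum `1 - n`. -/
structure IsTurningWeight (n : ℕ) (W : Fin (n + 1) → ℤ) : Prop where
  odd : ∀ i, Odd (W i)
  sum_eq : ∑ i, W i = 1 - (n : ℤ)

/-- A basis of the `n`-turning weight `W`: integers `k 0, …, k n` with `W 0 = 1 + 2 * k 0` and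
`W i = -1 + 2 * k i` for `1 ≤ i ≤ n`. -/
structure IsWeightBasis (n : ℕ) (W k : Fin (n + 1) → ℤ) : Prop where
  zero_eq : W 0 = 1 + 2 * k 0
  succ_eq : ∀ i : Fin n, W i.succ = -1 + 2 * k i.succ

/-- The entries of a basis of a turning weight necessarily sum to `0`. -/
theorem IsWeightBasis.sum_eq_zero {n : ℕ} {W k : Fin (n + 1) → ℤ} (hW : IsTurningWeight n W)
    (hk : IsWeightBasis n W k) : ∑ i, k i = 0 := by
  have h := hW.sum_eq
  rw [Fin.sum_univ_succ, hk.zero_eq] at h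
  simp only [hk.succ_eq, Finset.sum_add_distrib, ← Finset.mul_sum] at h
  rw [Fin.sum_univ_succ]
  simp at h
  linarith

/-- A closed round disc in the plane `ℝ² = ℂ` (index `0`), together with `n` open round discs
(indices `1, …, n`) in its interior, whose closures are pairwise disjoint and also lie in its
interior. -/
structure HoledDisc (n : ℕ) where
  center : Fin (n + 1) → ℂ
  radius : Fin (n + 1) → ℝ
  radius_pos : ∀ i, 0 < radius i
  hole_subset : ∀ i : Fin n,
    Metric.closedBall (center i.succ) (radius i.succ) ⊆ Metric.ball (center 0) (radius 0)
  hole_disjoint : ∀ i j : Fin n, i ≠ j →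
    Disjoint (Metric.closedBall (center i.succ) (radius i.succ))
      (Metric.closedBall (center j.succ) (radius j.succ))

namespace HoledDisc

variable {n : ℕ}

/-- The disc with `n` holes: the compact connected planar surface of Euler characteristic
`1 - n`. -/
def surface (D : HoledDisc n) : Set ℂ :=
  Metric.closedBall (D.center 0) (D.radius 0) \
    ⋃ i : Fin n, Metric.ball (D.center i.succ) (D.radius i.succ)

/-- The `j`-th boundary circle of the disc with holes (outer circle for `j = 0`, boundary of the
`j`-th hole otherwise), parametrized with period `2 * π`. For `σ = 1` it carries the boundary
orientation induced from the standard orientation of the plane (the surface lies to its left), so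
that the outer circle runs counterclockwise and the others clockwise; for `σ = -1` it carries the
opposite orientation. -/
noncomputable def boundaryCurve (D : HoledDisc n) (σ : ℝ) (j : Fin (n + 1)) (s : ℝ) : ℂ :=
  D.center j + D.radius j *
    Complex.exp (((if j = 0 then σ else -σ) * s : ℝ) * Complex.I)

end HoledDisc

/-- `c` is a smooth regular (immersed) closed plane curve, parametrized with period `2 * π`, and
its turning number is `t`: a continuous angle function `θ` of its velocity increases by
`2 * π * t` over one period. -/
def HasTurningNumber (c : ℝ → ℂ) (t : ℤ) : Prop :=
  ContDiff ℝ ∞ c ∧ Function.Periodic c (2 * Real.pi) ∧ (∀ s, deriv c s ≠ 0) ∧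
    ∃ θ : ℝ → ℝ, Continuous θ ∧
      (∀ s, deriv c s = ‖deriv c s‖ * Complex.exp (θ s * Complex.I)) ∧
      θ (2 * Real.pi) - θ 0 = 2 * Real.pi * t

/-- `ε` restricts to a smooth embedding of the plane region `K` into `ℝ² × ℝ`: it is smooth up to
the boundary of `K`, a homeomorphism onto its image, and its differential is injective at every
point of `K`. Only the values of `ε` on `K` matter. -/
structure IsSmoothEmbeddingOn (ε : ℂ → ℂ × ℝ) (K : Set ℂ) : Prop where
  contDiffOn : ContDiffOn ℝ ∞ ε K
  isEmbedding : Topology.IsEmbedding (K.domRestrict ε)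
  immersion : ∀ x ∈ K, Function.Injective (fderivWithin ℝ ε K x)

/-- The composition of `ε` with the projection of `ℝ² × ℝ` to `ℝ²`. -/
def planeProj (ε : ℂ → ℂ × ℝ) (z : ℂ) : ℂ := (ε z).1

/-- The `j`-th boundary curve of the disc with holes has, after applying `ε` and projecting to the
plane, turning number `t`. The curve is oriented as boundary of the surface, where the surface
carries the orientation pulled back from the plane by the projection of `ε`: for `σ = 1` this is
the orientation that the disc with holes has as a subset of the plane, for `σ = -1` the opposite
one. -/
def HasBoundaryTurningNumber {n : ℕ} (D : HoledDisc n) (ε : ℂ → ℂ × ℝ) (j : Fin (n + 1))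
    (t : ℤ) : Prop :=
  ∃ σ : ℝ, (σ = 1 ∨ σ = -1) ∧
    (∀ x ∈ interior D.surface, 0 < σ * (fderiv ℝ (planeProj ε) x).det) ∧
    HasTurningNumber (fun s => planeProj ε (D.boundaryCurve σ j s)) t

/-- `ε` is a geometric realization of `W`: it is a smooth embedding of the disc with holes, every
interior point is a regular point of the projection to the plane, and for some enumeration of the
boundary curves their turning numbers are the entries of `W`. -/
structure IsGeometricRealization {n : ℕ} (D : HoledDisc n) (ε : ℂ → ℂ × ℝ)
    (W : Fin (n + 1) → ℤ) : Prop where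
  embedding : IsSmoothEmbeddingOn ε D.surface
  regular : ∀ x ∈ interior D.surface, Function.Surjective (fderiv ℝ (planeProj ε) x)
  turning : ∃ e : Equiv.Perm (Fin (n + 1)), ∀ i, HasBoundaryTurningNumber D ε (e i) (W i)

/-!
The surface is mapped by `z ↦ (G (a z), Im (a z))`, where `a` is a complex number for which the
points `a c` (`c` a hole centre) lie at distinct heights. The plane map `G` is the identity except
on thin disjoint horizontal strips, one issuing to the right from each `p = a c`. There
`G (p + x + I y) = p + I y + ρ (exp (I θ(y)) - 1) + λ(y) x exp (I θ(y))`
with `θ` running from `0` to `2 π b` across the strip: the horizontal segments of the strip are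
contracted to a small size and then rotated `b` times, while their end points follow a small circle
of radius `|ρ|`. Such strips exist (`StripTwist.exists_nonempty`) because moving fast enough around
the circle makes the segments sweep out the plane without folding.

* Embedding: the last coordinate is the height, so only points at equal height have to be
  separated. `G` is injective on each horizontal line of the surface
  (`StripSystem.eq_of_map_eq`): the part to the right of a hole stays within the disc of
  the hole or to the right of its centre, and the part to the left is not moved.
* Turning numbers: the differential of `G` is `N T`, where `N` is the unit complex number
  `exp (I θ)` on the strips and `1` elsewhere, and `T` is upper triangular with positive diagonal
  (`StripSystem.exists_hasFDerivAt_map`). Since `T` has no negative eigenvalue it does not affect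
  turning numbers (`HasTurningNumber.of_slitPlane`), so the turning number of the image of a
  boundary circle is that of the circle plus the winding number of `N` along it. The function `N`
  is homotopic to the product of the `b`-th powers of the directions from the points `p`
  (`StripSystem.exists_stripFrame_eq`), whose winding along a circle is read off from the centres
  inside it (`HoledDisc.exists_angle`).

Hence the outer circle gets turning number `1 + ∑ b i` and the `i`-th hole `-(1 + b i)`. The `b i`
being arbitrary, every prescription with sum `1 - n` is attained, for any labelling of the circles.
-/

/-! ### The smooth step function -/

namespace Real.smoothTransition

theorem deriv_eq_zero {x : ℝ} (hx : x ≤ 0 ∨ 1 ≤ x) : deriv smoothTransition x = 0 := by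
  rcases hx with hx | hx
  · refine IsLocalMin.deriv_eq_zero (Filter.Eventually.of_forall fun y => ?_)
    rw [zero_of_nonpos hx]
    exact nonneg y
  · refine IsLocalMax.deriv_eq_zero (Filter.Eventually.of_forall fun y => ?_)
    rw [one_of_one_le hx]
    exact le_one y

theorem deriv_pos {x : ℝ} (h0 : 0 < x) (h1 : x < 1) : 0 < deriv smoothTransition x := by
  -- On `(0, 1)` the smooth step is the logistic function of `(1 - x)⁻¹ - x⁻¹`.
  have hev : smoothTransition =ᶠ[nhds x] fun y => (1 + exp (y⁻¹ - (1 - y)⁻¹))⁻¹ := by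
    filter_upwards [Ioo_mem_nhds h0 h1] with y hy
    have hy0 : ¬ y ≤ 0 := not_le.2 hy.1
    have hy1 : ¬ 1 - y ≤ 0 := by linarith [hy.2]
    have hexp : exp (y⁻¹ - (1 - y)⁻¹) = exp (-(1 - y)⁻¹) / exp (-y⁻¹) := by
      rw [← exp_sub, neg_sub_neg]
    rw [smoothTransition, expNegInvGlue, expNegInvGlue, if_neg hy0, if_neg hy1, hexp]
    have := exp_pos (-y⁻¹)
    field_simp
  have hx1 : (1 - x) ≠ 0 := by linarith
  have hinner : HasDerivAt (fun y : ℝ => y⁻¹ - (1 - y)⁻¹) (-(x ^ 2)⁻¹ - ((1 - x) ^ 2)⁻¹) x := by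
    have h2 : HasDerivAt (fun y : ℝ => (1 - y)⁻¹) (-(-1) / (1 - x) ^ 2) x :=
      ((hasDerivAt_id x).const_sub 1).fun_inv hx1
    exact ((hasDerivAt_inv h0.ne').fun_sub h2).congr_deriv (by ring)
  have hpos : (1 + exp (x⁻¹ - (1 - x)⁻¹)) ≠ 0 := by positivity
  have hmain := (hinner.exp.const_add 1).fun_inv hpos
  rw [hev.deriv_eq, hmain.deriv]
  have h3 : 0 < (x ^ 2)⁻¹ := by positivity
  have h4 : 0 < ((1 - x) ^ 2)⁻¹ := by positivity
  apply div_pos _ (by positivity)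
  rw [neg_pos]
  exact mul_neg_of_pos_of_neg (exp_pos _) (by linarith)

theorem deriv_nonneg (x : ℝ) : 0 ≤ deriv smoothTransition x := by
  rcases le_or_gt x 0 with h | h
  · exact (deriv_eq_zero (Or.inl h)).ge
  rcases le_or_gt 1 x with h' | h'
  · exact (deriv_eq_zero (Or.inr h')).ge
  exact (deriv_pos h h').le

theorem contDiff_top : ContDiff ℝ ∞ smoothTransition := smoothTransition.contDiff (n := ⊤)

theorem continuous_deriv : Continuous (deriv smoothTransition) :=
  contDiff_top.continuous_deriv (by simp)

theorem exists_deriv_le : ∃ B : ℝ, 0 < B ∧ ∀ x, deriv smoothTransition x ≤ B := by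
  obtain ⟨B, hB⟩ := (isCompact_Icc (a := (0 : ℝ)) (b := 1)).bddAbove_image
    continuous_deriv.continuousOn
  refine ⟨max B 1, by positivity, fun x => ?_⟩
  by_cases hx : x ∈ Set.Icc (0 : ℝ) 1
  · exact (hB (Set.mem_image_of_mem _ hx)).trans (le_max_left _ _)
  · rw [deriv_eq_zero]
    · positivity
    · by_contra! h
      exact hx ⟨h.1.le, h.2.le⟩

/-- While the angle `2 * π * b * smoothTransition x` points backwards, it is moving: a large
multiple of its speed outweighs its cosine. -/
theorem exists_cos_add_deriv (b : ℤ) : ∃ K : ℝ, 0 < K ∧ ∀ x,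
    1 / 2 ≤ cos (2 * π * b * smoothTransition x) +
      K * b * (2 * π * b * deriv smoothTransition x) := by
  set Z : Set ℝ := Set.Icc 0 1 ∩ {x | cos (2 * π * b * smoothTransition x) ≤ 1 / 2} with hZ
  have hcont : Continuous fun x => cos (2 * π * b * smoothTransition x) :=
    continuous_cos.comp (continuous_const.mul smoothTransition.continuous)
  have hZc : IsCompact Z := isCompact_Icc.inter_right (isClosed_le hcont continuous_const)
  have hb : ∀ x ∈ Z, (1 : ℝ) ≤ b * b := by
    intro x hx
    have : b ≠ 0 := by
      rintro rfl
      have := hx.2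
      norm_num at this
    exact_mod_cast Int.one_le_abs this |>.trans (by
      rw [← abs_mul_abs_self b]
      nlinarith [Int.one_le_abs this])
  have hpos : ∀ x ∈ Z, 0 < deriv smoothTransition x := by
    intro x hx
    obtain ⟨⟨h0, h1⟩, hc⟩ := hx
    rw [Set.mem_ofPred_eq] at hc
    apply deriv_pos
    · refine lt_of_le_of_ne h0 ?_
      rintro rfl
      norm_num at hc
    · refine lt_of_le_of_ne h1 ?_
      rintro rfl
      rw [smoothTransition.one, mul_one, mul_comm, cos_int_mul_two_pi] at hc
      norm_num at hc
  obtain ⟨m, hm, hmZ⟩ : ∃ m : ℝ, 0 < m ∧ ∀ x ∈ Z, m ≤ deriv smoothTransition x := by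
    rcases Z.eq_empty_or_nonempty with he | hne
    · exact ⟨1, one_pos, by simp [he]⟩
    · obtain ⟨x, hx, hmin⟩ := hZc.exists_isMinOn hne continuous_deriv.continuousOn
      exact ⟨_, hpos x hx, fun y hy => hmin hy⟩
  refine ⟨2 / m, by positivity, fun x => ?_⟩
  have hd := deriv_nonneg x
  have hterm : 2 / m * b * (2 * π * b * deriv smoothTransition x) =
      (2 * π) * (b * b) * (2 / m * deriv smoothTransition x) := by ring
  have hterm0 : 0 ≤ 2 / m * b * (2 * π * b * deriv smoothTransition x) := by
    rw [hterm]
    have := mul_self_nonneg (b : ℝ)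
    positivity
  by_cases hx : x ∈ Z
  · have h1 := hmZ x hx
    have h2 : 2 ≤ 2 / m * deriv smoothTransition x := by
      rw [div_mul_eq_mul_div, le_div_iff₀ hm]
      linarith
    have h3 : 1 ≤ 2 * π * (b * b : ℝ) := by nlinarith [hb x hx, pi_gt_three]
    have h4 := neg_one_le_cos (2 * π * b * smoothTransition x)
    rw [hterm]
    nlinarith
  · by_cases hI : x ∈ Set.Icc (0 : ℝ) 1
    · have : 1 / 2 < cos (2 * π * b * smoothTransition x) := by
        by_contra! h
        exact hx ⟨hI, h⟩
      linarith
    · have hcos : cos (2 * π * b * smoothTransition x) = 1 := by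
        rw [Set.mem_Icc, not_and_or, not_le, not_le] at hI
        rcases hI with h | h
        · simp [zero_of_nonpos h.le]
        · rw [one_of_one_le h.le, mul_one, mul_comm, cos_int_mul_two_pi]
      linarith

end Real.smoothTransition

/-! ### The twisted strip -/

open Complex in
/-- The profile of a ribbon map `(x, y) ↦ I y + ρ (exp (I θ(y)) - 1) + scale(y) x exp (I θ(y))`
on the strip `0 < x ≤ X`, `|y| < δ`. The ribbon is the identity near `δ ≤ |y|`, and in between the
direction `exp (I θ(y))` of its cross sections `y = const` makes `b` full turns. -/
structure StripTwist (b : ℤ) (r X δ : ℝ) where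
  /-- The angle of the cross section at height `y`. -/
  θ : ℝ → ℝ
  /-- The factor by which the cross section at height `y` is contracted. -/
  scale : ℝ → ℝ
  /-- The signed radius of the circle on which the base points `x = 0` of the cross sections turn.
  A sign equal to that of `b` makes the cross sections advance to the left of their direction. -/
  ρ : ℝ
  contDiff_θ : ContDiff ℝ ∞ θ
  contDiff_scale : ContDiff ℝ ∞ scale
  scale_pos : ∀ y, 0 < scale y
  scale_eq_one : ∀ y, δ ≤ |y| → scale y = 1
  θ_eq_zero : ∀ y, y ≤ -δ → θ y = 0
  θ_eq_turns : ∀ y, δ ≤ y → θ y = 2 * Real.pi * b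
  /-- The ribbon map is an orientation preserving immersion. -/
  transverse : ∀ x y, 0 < x → x ≤ X →
    0 < Real.cos (θ y) + ρ * deriv θ y + scale y * x * deriv θ y
  /-- The ribbon misses the points to its left at the same height outside the disc of
  radius `r`. -/
  avoid : ∀ x y x' : ℝ, 0 < x → x ≤ X → |y| < δ → x' ≤ 0 → r ≤ ‖(⟨x', y⟩ : ℂ)‖ →
    I * y + ρ * (exp (θ y * I) - 1) + scale y * x * exp (θ y * I) ≠ ⟨x', y⟩

open Complex Real.smoothTransition in
/-- Twisted strips with any number of turns exist, provided that they are thin enough. -/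
theorem StripTwist.exists_nonempty (b : ℤ) {r X : ℝ} (hr : 0 < r) (hX : 0 < X) :
    ∃ δ₀ : ℝ, 0 < δ₀ ∧ ∀ δ, 0 < δ → δ < δ₀ → Nonempty (StripTwist b r X δ) := by
  obtain ⟨K, hK, hKcos⟩ := exists_cos_add_deriv b
  obtain ⟨B, hB, hBle⟩ := exists_deriv_le
  refine ⟨r / (2 * (1 + 2 * K * |b|)), by positivity, fun δ hδ hδr => ?_⟩
  have hδr' : δ * (1 + 2 * K * |b|) < r / 2 := by
    rw [lt_div_iff₀ (by positivity)] at hδr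
    linarith
  -- The contraction factor `μ` in the middle of the strip makes the ribbon narrow compared both
  -- with its curvature radius and with `r`.
  set C : ℝ := 8 * Real.pi * |b| * B * X / δ + 4 * X / r with hC
  have hC0 : 0 ≤ C := by positivity
  obtain ⟨μ, hμ, hμ1, hμC⟩ : ∃ μ : ℝ, 0 < μ ∧ μ ≤ 1 ∧ μ * C ≤ 1 :=
    ⟨1 / (1 + C), by positivity, by rw [div_le_one (by positivity)]; linarith,
      by rw [div_mul_eq_mul_div, div_le_one (by positivity)]; linarith⟩
  have hμ2 : μ * X ≤ r / 4 := by
    have : μ * (4 * X / r) ≤ 1 := by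
      refine le_trans (mul_le_mul_of_nonneg_left ?_ hμ.le) hμC
      rw [hC]
      linarith [show 0 ≤ 8 * Real.pi * |b| * B * X / δ by positivity]
    rw [← mul_div_assoc, div_le_one hr] at this
    linarith
  have hμ3 : μ * X * (2 * Real.pi * |b| * B / δ) ≤ 1 / 4 := by
    have : μ * (8 * Real.pi * |b| * B * X / δ) ≤ 1 := by
      refine le_trans (mul_le_mul_of_nonneg_left ?_ hμ.le) hμC
      rw [hC]
      linarith [show 0 ≤ 4 * X / r by positivity]
    have h2 : μ * X * (2 * Real.pi * |b| * B / δ) =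
      μ * (8 * Real.pi * |b| * B * X / δ) / 4 := by ring
    rw [h2]
    linarith
  set S := Real.smoothTransition with hS
  have hSc : ContDiff ℝ ∞ S := contDiff_top
  set θ : ℝ → ℝ := fun y => 2 * Real.pi * b * S (y / δ + 1 / 2) with hθ
  set scale : ℝ → ℝ := fun y => 1 - (1 - μ) * (S (2 + 2 * y / δ) * S (2 - 2 * y / δ)) with hscale
  have hθlow : ∀ y, y ≤ -(δ / 2) → θ y = 0 := by
    intro y hy
    have : y / δ + 1 / 2 ≤ 0 := by
      have : y / δ ≤ -(1 / 2) := by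
        rw [div_le_iff₀ hδ]
        linarith
      linarith
    simp only [hθ, hS, zero_of_nonpos this, mul_zero]
  have hθhigh : ∀ y, δ / 2 ≤ y → θ y = 2 * Real.pi * b := by
    intro y hy
    have : 1 ≤ y / δ + 1 / 2 := by
      have : 1 / 2 ≤ y / δ := by
        rw [le_div_iff₀ hδ]
        linarith
      linarith
    simp only [hθ, hS, one_of_one_le this, mul_one]
  have hexp : ∀ y, δ / 2 ≤ |y| → exp (θ y * I) = 1 := by
    intro y hy
    rcases le_abs'.1 hy with h | h
    · simp [hθlow y h]
    · rw [hθhigh y h, Complex.exp_eq_one_iff]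
      exact ⟨b, by push_cast; ring⟩
  have hderiv : ∀ y, deriv θ y = 2 * Real.pi * b * deriv S (y / δ + 1 / 2) / δ := by
    intro y
    have h1 : HasDerivAt (fun y : ℝ => y / δ + 1 / 2) (1 / δ) y :=
      ((hasDerivAt_id y).div_const δ).add_const _
    have h2 : HasDerivAt S (deriv S (y / δ + 1 / 2)) (y / δ + 1 / 2) :=
      (hSc.differentiable (by simp) _).hasDerivAt
    have h3 := ((h2.comp y h1).const_mul (2 * Real.pi * b)).deriv
    rw [show θ = fun y => 2 * Real.pi * b * (S ∘ fun y : ℝ => y / δ + 1 / 2) y from rfl, h3]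
    ring
  have hmid : ∀ y, |y| ≤ δ / 2 → scale y = μ := by
    intro y hy
    obtain ⟨h1, h2⟩ := abs_le.1 hy
    have h3 : 1 ≤ 2 + 2 * y / δ := by
      have : -1 ≤ 2 * y / δ := by
        rw [le_div_iff₀ hδ]
        linarith
      linarith
    have h4 : 1 ≤ 2 - 2 * y / δ := by
      have : 2 * y / δ ≤ 1 := by
        rw [div_le_iff₀ hδ]
        linarith
      linarith
    simp only [hscale, hS, one_of_one_le h3, one_of_one_le h4]
    ring
  have hscale_pos : ∀ y, 0 < scale y := by
    intro y
    have h1 : S (2 + 2 * y / δ) * S (2 - 2 * y / δ) ≤ 1 :=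
      mul_le_one₀ (le_one _) (nonneg _) (le_one _)
    have h0 : 0 ≤ S (2 + 2 * y / δ) * S (2 - 2 * y / δ) := mul_nonneg (nonneg _) (nonneg _)
    simp only [hscale]
    nlinarith
  refine ⟨⟨θ, scale, δ * K * b, ?_, ?_, hscale_pos, ?_, ?_, ?_, ?_, ?_⟩⟩
  · exact contDiff_const.mul (hSc.comp (by fun_prop))
  · exact contDiff_const.sub (contDiff_const.mul
      ((hSc.comp (by fun_prop)).mul (hSc.comp (by fun_prop))))
  · intro y hy
    have : S (2 + 2 * y / δ) * S (2 - 2 * y / δ) = 0 := by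
      rcases le_abs'.1 hy with h | h
      · rw [hS, zero_of_nonpos (x := 2 + 2 * y / δ), zero_mul]
        have : 2 * y / δ ≤ -2 := by
          rw [div_le_iff₀ hδ]
          linarith
        linarith
      · rw [hS, zero_of_nonpos (x := 2 - 2 * y / δ), mul_zero]
        have : 2 ≤ 2 * y / δ := by
          rw [le_div_iff₀ hδ]
          linarith
        linarith
    simp only [hscale, this]
    ring
  · exact fun y hy => hθlow y (by linarith)
  · exact fun y hy => hθhigh y (by linarith)
  · intro x y hx hxX
    set d := deriv S (y / δ + 1 / 2) with hd
    have hd0 : 0 ≤ d := deriv_nonneg _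
    have h1 : Real.cos (θ y) + δ * K * b * deriv θ y =
        Real.cos (2 * Real.pi * b * S (y / δ + 1 / 2)) + K * b * (2 * Real.pi * b * d) := by
      rw [hderiv, show δ * K * b * (2 * Real.pi * b * deriv S (y / δ + 1 / 2) / δ) =
        K * b * (2 * Real.pi * b * d) by rw [← hd]; field_simp]
    have h2 := hKcos (y / δ + 1 / 2)
    rw [← hd, ← h1] at h2
    have h3 : -(1 / 4) ≤ scale y * x * deriv θ y := by
      rcases le_or_gt (δ / 2) |y| with hy | hy
      · have : deriv θ y = 0 := by
          rw [hderiv, hS, deriv_eq_zero]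
          · simp
          rcases le_abs'.1 hy with h | h
          · left
            have : y / δ ≤ -(1 / 2) := by
              rw [div_le_iff₀ hδ]
              linarith
            linarith
          · right
            have : 1 / 2 ≤ y / δ := by
              rw [le_div_iff₀ hδ]
              linarith
            linarith
        rw [this]
        norm_num
      · rw [hmid y hy.le]
        have habs : |μ * x * deriv θ y| ≤ μ * X * (2 * Real.pi * |b| * B / δ) := by
          rw [abs_mul, abs_of_pos (mul_pos hμ hx), hderiv, abs_div, abs_of_pos hδ, abs_mul,
            abs_mul, abs_of_pos Real.two_pi_pos, abs_of_nonneg hd0]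
          have := hBle (y / δ + 1 / 2)
          push_cast
          gcongr
        linarith [(abs_le.1 habs).1]
    linarith
  · intro x y x' hx hxX hy hx' hr' heq
    rcases le_or_gt (δ / 2) |y| with h | h
    · rw [hexp y h] at heq
      have := congrArg Complex.re heq
      simp at this
      nlinarith [mul_pos (hscale_pos y) hx]
    · rw [← heq, hmid y h.le] at hr'
      have hn : ‖exp (θ y * I)‖ = 1 := norm_exp_ofReal_mul_I _
      have h1 : ‖I * (y : ℂ)‖ ≤ δ := by
        rw [norm_mul, norm_I, one_mul, norm_real, Real.norm_eq_abs]
        exact hy.le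
      have h2 : ‖((δ * K * b : ℝ) : ℂ) * (exp (θ y * I) - 1)‖ ≤ δ * K * |b| * 2 := by
        rw [norm_mul, norm_real, Real.norm_eq_abs, abs_mul, abs_of_pos (mul_pos hδ hK)]
        push_cast
        gcongr
        exact (norm_sub_le _ _).trans (by rw [hn, norm_one]; norm_num)
      have h3 : ‖(μ : ℂ) * x * exp (θ y * I)‖ ≤ r / 4 := by
        rw [norm_mul, norm_mul, hn, norm_real, norm_real, Real.norm_eq_abs, Real.norm_eq_abs,
          abs_of_pos hμ, abs_of_pos hx, mul_one]
        exact (mul_le_mul_of_nonneg_left hxX hμ.le).trans hμ2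
      have := norm_add₃_le (a := I * (y : ℂ)) (b := ((δ * K * b : ℝ) : ℂ) * (exp (θ y * I) - 1))
        (c := (μ : ℂ) * x * exp (θ y * I))
      nlinarith

open Complex

namespace StripTwist

variable {b : ℤ} {r X δ : ℝ} (T : StripTwist b r X δ)

/-- The ribbon map of a twisted strip, in coordinates centred at the base point of the strip. -/
noncomputable def ribbon (w : ℂ) : ℂ :=
  I * w.im + T.ρ * (exp (T.θ w.im * I) - 1) + T.scale w.im * w.re * exp (T.θ w.im * I)

theorem exp_θ_eq_one {y : ℝ} (hy : δ ≤ |y|) : exp (T.θ y * I) = 1 := by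
  rcases le_abs'.1 hy with h | h
  · simp [T.θ_eq_zero y h]
  · rw [T.θ_eq_turns y h, Complex.exp_eq_one_iff]
    exact ⟨b, by push_cast; ring⟩

theorem ribbon_eq_self {w : ℂ} (hw : δ ≤ |w.im|) : T.ribbon w = w := by
  rw [ribbon, T.exp_θ_eq_one hw, T.scale_eq_one _ hw]
  apply Complex.ext <;> simp

theorem contDiff_ribbon : ContDiff ℝ ∞ T.ribbon := by
  have him : ContDiff ℝ ∞ fun w : ℂ => w.im := imCLM.contDiff
  have hre : ContDiff ℝ ∞ fun w : ℂ => w.re := reCLM.contDiff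
  have hof : ContDiff ℝ ∞ (fun x : ℝ => (x : ℂ)) := ofRealCLM.contDiff
  have hθ : ContDiff ℝ ∞ fun w : ℂ => exp (T.θ w.im * I) :=
    ((hof.comp (T.contDiff_θ.comp him)).mul contDiff_const).cexp
  exact ((contDiff_const.mul (hof.comp him)).add (contDiff_const.mul (hθ.sub contDiff_const))).add
    (((hof.comp (T.contDiff_scale.comp him)).mul (hof.comp hre)).mul hθ)

/-- In the rotating frame `exp (I θ)` the differential of the ribbon map is upper triangular. -/
theorem exists_hasFDerivAt_ribbon (w : ℂ) : ∃ L : ℂ →L[ℝ] ℂ, HasFDerivAt T.ribbon L w ∧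
    ∃ κ : ℝ, ∀ v, L v = exp (T.θ w.im * I) * ((T.scale w.im * v.re + κ * v.im : ℝ) +
      ((Real.cos (T.θ w.im) + T.ρ * deriv T.θ w.im + T.scale w.im * w.re * deriv T.θ w.im) * v.im :
        ℝ) * I) := by
  have him : HasFDerivAt (fun w : ℂ => w.im) imCLM w := imCLM.hasFDerivAt
  have hre : HasFDerivAt (fun w : ℂ => (w.re : ℂ)) (ofRealCLM.comp reCLM) w :=
    (ofRealCLM.comp reCLM).hasFDerivAt
  have him' : HasFDerivAt (fun w : ℂ => (w.im : ℂ)) (ofRealCLM.comp imCLM) w :=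
    (ofRealCLM.comp imCLM).hasFDerivAt
  have hθ : HasFDerivAt (fun w : ℂ => (T.θ w.im : ℂ))
      (ofRealCLM.comp (deriv T.θ w.im • imCLM)) w :=
    ofRealCLM.hasFDerivAt.comp w
      (((T.contDiff_θ.differentiable (by simp) _).hasDerivAt).comp_hasFDerivAt w him)
  have hs : HasFDerivAt (fun w : ℂ => (T.scale w.im : ℂ))
      (ofRealCLM.comp (deriv T.scale w.im • imCLM)) w :=
    ofRealCLM.hasFDerivAt.comp w
      (((T.contDiff_scale.differentiable (by simp) _).hasDerivAt).comp_hasFDerivAt w him)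
  have he := (hθ.mul_const I).cexp
  have hmain := ((him'.const_mul I).add ((he.sub_const 1).const_mul (T.ρ : ℂ))).add
    ((hs.mul hre).mul he)
  refine ⟨_, hmain, Real.sin (T.θ w.im) + deriv T.scale w.im * w.re, fun v => ?_⟩
  have hI : I = exp (T.θ w.im * I) * ((Real.sin (T.θ w.im) : ℝ) + (Real.cos (T.θ w.im) : ℝ) * I) := by
    have h1 := Real.sin_sq_add_cos_sq (T.θ w.im)
    rw [exp_mul_I, ← ofReal_cos, ← ofReal_sin]
    apply Complex.ext
    · simp [-ofReal_cos, -ofReal_sin]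
      ring
    · simp [-ofReal_cos, -ofReal_sin]
      nlinarith
  have hI2 : I * v.im = exp (T.θ w.im * I) *
      ((Real.sin (T.θ w.im) : ℝ) + (Real.cos (T.θ w.im) : ℝ) * I) * v.im := by
    rw [← hI]
  simp only [add_apply, smul_apply,
    ContinuousLinearMap.comp_apply, ofRealCLM_apply, reCLM_apply, imCLM_apply, smul_eq_mul,
    Pi.mul_apply]
  rw [hI2]
  push_cast
  ring

end StripTwist

/-! ### A plane map twisted along parallel strips -/

theorem Complex.div_norm_eq_exp_arg {u : ℂ} (hu : u ≠ 0) : u / ‖u‖ = exp (arg u * I) := by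
  rw [div_eq_iff (by simpa using hu), mul_comm, norm_mul_exp_arg_mul_I]

/-- Twisted strips issuing horizontally to the right from base points `p i` at distinct heights.
The strip at `p i` is at most `X` long and makes `b i` turns; the discs of radius `r i` about the
base points are to be left out. -/
structure StripSystem (n : ℕ) where
  b : Fin n → ℤ
  p : Fin n → ℂ
  r : Fin n → ℝ
  X : ℝ
  δ : ℝ
  δ_pos : 0 < δ
  δ_lt : ∀ i, δ < r i
  sep : ∀ i j, i ≠ j → 4 * δ < |(p i).im - (p j).im|
  strip : ∀ i, StripTwist (b i) (r i) X δ

namespace StripSystem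

variable {n : ℕ} (Y : StripSystem n)

/-- The points outside the discs about the base points and within the reach of the strips. -/
def region : Set ℂ := {w | ∀ i, Y.r i ≤ ‖w - Y.p i‖ ∧ ‖w - Y.p i‖ ≤ Y.X}

/-- The map that is the ribbon map on each strip and the identity elsewhere. -/
noncomputable def map (w : ℂ) : ℂ :=
  w + ∑ i, if (Y.p i).re < w.re then (Y.strip i).ribbon (w - Y.p i) - (w - Y.p i) else 0

/-- The factor of `StripSystem.frame` contributed by one strip. -/
noncomputable def stripFrame (i : Fin n) (w : ℂ) : ℂ :=
  if (Y.p i).re < w.re then exp ((Y.strip i).θ (w - Y.p i).im * I) else 1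

/-- The direction of the image under `StripSystem.map` of the horizontal direction. -/
noncomputable def frame (w : ℂ) : ℂ := ∏ i, Y.stripFrame i w

variable {Y}

theorem p_im_injective {i j : Fin n} {y : ℝ} (hi : |y - (Y.p i).im| < 3 * Y.δ)
    (hj : |y - (Y.p j).im| < Y.δ) : i = j := by
  by_contra hij
  have h1 := Y.sep i j hij
  have h2 := abs_sub_le (Y.p i).im y (Y.p j).im
  rw [abs_sub_comm _ y] at h2
  linarith

theorem map_term_eq_zero {i : Fin n} {w : ℂ}
    (h : w.re ≤ (Y.p i).re ∨ Y.δ ≤ |w.im - (Y.p i).im|) :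
    (if (Y.p i).re < w.re then (Y.strip i).ribbon (w - Y.p i) - (w - Y.p i) else 0) = 0 := by
  split_ifs with h'
  · rw [(Y.strip i).ribbon_eq_self (by simpa using h.resolve_left (not_le.2 h')), sub_self]
  · rfl

theorem stripFrame_eq_one {i : Fin n} {w : ℂ}
    (h : w.re ≤ (Y.p i).re ∨ Y.δ ≤ |w.im - (Y.p i).im|) : Y.stripFrame i w = 1 := by
  rw [stripFrame]
  split_ifs with h'
  · rw [(Y.strip i).exp_θ_eq_one (by simpa using h.resolve_left (not_le.2 h'))]
  · rfl

theorem map_eq_self {w : ℂ} (h : ∀ i, w.re ≤ (Y.p i).re ∨ Y.δ ≤ |w.im - (Y.p i).im|) :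
    Y.map w = w := by
  rw [map, Finset.sum_eq_zero fun i _ => map_term_eq_zero (h i), add_zero]

theorem frame_eq_one {w : ℂ} (h : ∀ i, w.re ≤ (Y.p i).re ∨ Y.δ ≤ |w.im - (Y.p i).im|) :
    Y.frame w = 1 :=
  Finset.prod_eq_one fun i _ => stripFrame_eq_one (h i)

theorem map_eq_ribbon {i : Fin n} {w : ℂ} (hre : (Y.p i).re < w.re)
    (him : |w.im - (Y.p i).im| < 3 * Y.δ) :
    Y.map w = Y.p i + (Y.strip i).ribbon (w - Y.p i) := by
  rw [map, Finset.sum_eq_single i, if_pos hre]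
  · ring
  · intro j _ hj
    refine map_term_eq_zero (Or.inr ?_)
    by_contra! h
    exact hj (p_im_injective him h).symm
  · simp

theorem frame_eq_exp {i : Fin n} {w : ℂ} (hre : (Y.p i).re < w.re)
    (him : |w.im - (Y.p i).im| < 3 * Y.δ) :
    Y.frame w = exp ((Y.strip i).θ (w - Y.p i).im * I) := by
  rw [frame, Finset.prod_eq_single i, stripFrame, if_pos hre]
  · intro j _ hj
    refine stripFrame_eq_one (Or.inr ?_)
    by_contra! h
    exact hj (p_im_injective him h).symm
  · simp

theorem lt_abs_im_of_re_eq {w : ℂ} (hw : w ∈ Y.region) {i : Fin n} (h : w.re = (Y.p i).re) :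
    Y.δ < |w.im - (Y.p i).im| := by
  have h1 : ‖w - Y.p i‖ = |w.im - (Y.p i).im| := by
    rw [← sub_im, abs_im_eq_norm.2]
    simp [h]
  rw [← h1]
  exact (Y.δ_lt i).trans_le (hw i).1

/-- Near each point of the region the map is a single ribbon map or the identity. -/
theorem eventuallyEq_ribbon_or_id {w : ℂ} (hw : w ∈ Y.region) :
    (∃ i, (Y.p i).re < w.re ∧ |w.im - (Y.p i).im| < 3 * Y.δ ∧
      Y.map =ᶠ[nhds w] fun v => Y.p i + (Y.strip i).ribbon (v - Y.p i)) ∨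
    (Y.frame w = 1 ∧ Y.map =ᶠ[nhds w] id) := by
  have hre : Continuous fun v : ℂ => v.re := continuous_re
  have him : ∀ i, Continuous fun v : ℂ => |v.im - (Y.p i).im| := fun i =>
    (continuous_im.sub continuous_const).abs
  by_cases h : ∃ i, (Y.p i).re < w.re ∧ |w.im - (Y.p i).im| < 3 * Y.δ
  · obtain ⟨i, h1, h2⟩ := h
    refine Or.inl ⟨i, h1, h2, ?_⟩
    filter_upwards [continuousAt_const.eventually_lt hre.continuousAt h1,
      (him i).continuousAt.eventually_lt continuousAt_const h2] with v hv1 hv2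
    exact map_eq_ribbon hv1 hv2
  · push Not at h
    have key : ∀ i, ∀ᶠ v in nhds w, v.re ≤ (Y.p i).re ∨ Y.δ ≤ |v.im - (Y.p i).im| := by
      intro i
      have hδ := Y.δ_pos
      rcases lt_trichotomy w.re (Y.p i).re with h1 | h1 | h1
      · filter_upwards [hre.continuousAt.eventually_lt continuousAt_const h1] with v hv
        exact Or.inl hv.le
      · filter_upwards [continuousAt_const.eventually_lt (him i).continuousAt
          (lt_abs_im_of_re_eq hw h1)] with v hv
        exact Or.inr hv.le
      · filter_upwards [continuousAt_const.eventually_lt (him i).continuousAt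
          (show Y.δ < _ by linarith [h i h1])] with v hv
        exact Or.inr hv.le
    have key' := Filter.eventually_all.2 key
    exact Or.inr ⟨frame_eq_one key'.self_of_nhds, key'.mono fun v hv => map_eq_self hv⟩

theorem contDiffAt_map {w : ℂ} (hw : w ∈ Y.region) : ContDiffAt ℝ ∞ Y.map w := by
  rcases eventuallyEq_ribbon_or_id hw with ⟨i, -, -, h⟩ | ⟨-, h⟩
  · refine ContDiffAt.congr_of_eventuallyEq ?_ h
    exact (contDiff_const.add ((Y.strip i).contDiff_ribbon.comp
      (contDiff_id.sub contDiff_const))).contDiffAt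
  · exact contDiffAt_id.congr_of_eventuallyEq h

/-- Up to the rotation `StripSystem.frame`, the differential of the map is upper triangular with
positive diagonal. -/
theorem exists_hasFDerivAt_map {w : ℂ} (hw : w ∈ Y.region) :
    ∃ L : ℂ →L[ℝ] ℂ, HasFDerivAt Y.map L w ∧ ∃ l κ ν : ℝ, 0 < l ∧ 0 < ν ∧
      ∀ v, L v = Y.frame w * ((l * v.re + κ * v.im : ℝ) + (ν * v.im : ℝ) * I) := by
  rcases eventuallyEq_ribbon_or_id hw with ⟨i, h1, h2, h⟩ | ⟨h1, h⟩
  · obtain ⟨L, hL, κ, hLv⟩ := (Y.strip i).exists_hasFDerivAt_ribbon (w - Y.p i)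
    refine ⟨L, ?_, (Y.strip i).scale (w - Y.p i).im, κ, _, (Y.strip i).scale_pos _,
      (Y.strip i).transverse (w - Y.p i).re (w - Y.p i).im ?_ ?_, fun v => ?_⟩
    · refine HasFDerivAt.congr_of_eventuallyEq ?_ h
      have := hL.comp w ((hasFDerivAt_id (𝕜 := ℝ) w).sub_const (Y.p i))
      rw [ContinuousLinearMap.comp_id] at this
      exact this.const_add _
    · simpa using h1
    · exact (re_le_norm _).trans (hw i).2
    · rw [hLv, frame_eq_exp h1 h2]
  · refine ⟨_, (hasFDerivAt_id (𝕜 := ℝ) w).congr_of_eventuallyEq h, 1, 0, 1, one_pos, one_pos,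
      fun v => ?_⟩
    rw [h1]
    simp [re_add_im]

/-- The map is injective on each horizontal line. -/
theorem eq_of_map_eq {w w' : ℂ} (hw : w ∈ Y.region) (hw' : w' ∈ Y.region) (him : w.im = w'.im)
    (h : Y.map w = Y.map w') : w = w' := by
  by_cases hi : ∃ i, |w.im - (Y.p i).im| < Y.δ
  · obtain ⟨i, hi⟩ := hi
    have hi' : |w'.im - (Y.p i).im| < Y.δ := him ▸ hi
    have hδ := Y.δ_pos
    -- The points to the left of the base point are fixed.
    have hleft : ∀ v : ℂ, |v.im - (Y.p i).im| < Y.δ → v.re ≤ (Y.p i).re → Y.map v = v := by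
      intro v hv hre
      refine map_eq_self fun j => ?_
      by_cases hj : i = j
      · exact Or.inl (hj ▸ hre)
      · refine Or.inr ?_
        by_contra! hv'
        exact hj (p_im_injective (hv.trans (by linarith)) hv')
    have hmixed : ∀ v v' : ℂ, v ∈ Y.region → v' ∈ Y.region → v.im = v'.im →
        |v.im - (Y.p i).im| < Y.δ → (Y.p i).re < v.re → v'.re ≤ (Y.p i).re →
        Y.map v ≠ Y.map v' := by
      intro v v' hv hv' hvv hvi hre hre' heq
      rw [hleft v' (hvv ▸ hvi) hre', map_eq_ribbon hre (hvi.trans (by linarith))] at heq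
      have hv'eq : v' - Y.p i = ⟨(v' - Y.p i).re, (v - Y.p i).im⟩ := by
        apply Complex.ext
        · rfl
        · simp [hvv]
      refine (Y.strip i).avoid (v - Y.p i).re (v - Y.p i).im (v' - Y.p i).re (by simpa using hre)
        ((re_le_norm _).trans (hv i).2) (by simpa using hvi) (by simpa using hre') ?_ ?_
      · rw [← hv'eq]
        exact (hv' i).1
      · rw [← hv'eq, ← heq, StripTwist.ribbon]
        ring
    rcases le_or_gt w.re (Y.p i).re with h1 | h1 <;> rcases le_or_gt w'.re (Y.p i).re with h2 | h2
    · rwa [hleft w hi h1, hleft w' hi' h2] at h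
    · exact absurd h.symm (hmixed w' w hw' hw him.symm hi' h2 h1)
    · exact absurd h (hmixed w w' hw hw' him hi h1 h2)
    · rw [map_eq_ribbon h1 (hi.trans (by linarith)), map_eq_ribbon h2 (hi'.trans (by linarith)),
        add_right_inj, StripTwist.ribbon, StripTwist.ribbon, sub_im, sub_im, ← him, add_right_inj,
        mul_left_inj' (exp_ne_zero _),
        mul_right_inj' (ofReal_ne_zero.2 ((Y.strip i).scale_pos _).ne'), ofReal_inj] at h
      exact Complex.ext (by simpa using h) him
  · push Not at hi
    rwa [map_eq_self fun i => Or.inr (hi i), map_eq_self fun i => Or.inr (him ▸ hi i)] at h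

/-- The frame of one strip is homotopic, through a continuous logarithm of the quotient, to the
`b`-th power of the direction from the base point. -/
theorem exists_stripFrame_eq (i : Fin n) : ∃ Λ : ℂ → ℝ, ContinuousOn Λ Y.region ∧
    ∀ w ∈ Y.region, Y.stripFrame i w =
      exp (Λ w * I) * ((w - Y.p i) / ‖w - Y.p i‖) ^ Y.b i := by
  set q := Y.p i with hq
  -- The logarithm off the slit to the right of the base point.
  set left : ℂ → ℝ := fun w => Y.b i * (Real.pi - arg (-(w - q))) with hleft
  have hleft_cont : ∀ w, -(w - q) ∈ slitPlane → ContinuousAt left w := by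
    intro w hw
    have h1 : ContinuousAt (fun w => arg (-(w - q))) w :=
      ContinuousAt.comp (f := fun w => -(w - q)) (continuousAt_arg hw) (by fun_prop)
    exact continuousAt_const.mul (continuousAt_const.sub h1)
  refine ⟨fun w => if q.re < w.re then (Y.strip i).θ (w - q).im - Y.b i * arg (w - q) else left w,
    fun w hw => ContinuousAt.continuousWithinAt ?_, fun w hw => ?_⟩
  · rcases lt_trichotomy w.re q.re with h | h | h
    · refine (hleft_cont w (Or.inl (by simpa using h))).congr ?_
      filter_upwards [continuous_re.continuousAt.eventually_lt continuousAt_const h] with v hv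
      rw [if_neg hv.not_gt]
    · have hδ := lt_abs_im_of_re_eq hw h
      have hδ0 := Y.δ_pos
      have him : w.im - q.im ≠ 0 := by
        intro h0
        rw [← hq, h0, abs_zero] at hδ
        linarith
      refine (hleft_cont w (Or.inr (by
        rw [neg_im, sub_im]
        exact neg_ne_zero.2 him))).congr ?_
      have hcont : Continuous fun v : ℂ => v.im - q.im := continuous_im.sub continuous_const
      rcases lt_abs.1 hδ with hpos | hneg
      · filter_upwards [continuousAt_const.eventually_lt hcont.continuousAt hpos] with v hv
        split_ifs with hv'
        · rw [(Y.strip i).θ_eq_turns _ (by simpa using hv.le), hleft]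
          simp only
          rw [arg_neg_eq_arg_sub_pi_of_im_pos (by rw [sub_im]; linarith)]
          ring
        · rfl
      · have hneg' : w.im - q.im < -Y.δ := by linarith
        filter_upwards [hcont.continuousAt.eventually_lt continuousAt_const hneg'] with v hv
        split_ifs with hv'
        · rw [(Y.strip i).θ_eq_zero _ (by simpa using hv.le), hleft]
          simp only
          rw [arg_neg_eq_arg_add_pi_of_im_neg (by rw [sub_im]; linarith)]
          ring
        · rfl
    · have hc : ContinuousAt
          (fun w => (Y.strip i).θ (w - q).im - Y.b i * arg (w - q)) w := by
        have h1 : ContinuousAt (fun w => arg (w - q)) w :=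
          ContinuousAt.comp (f := fun w => w - q)
            (continuousAt_arg (Or.inl (by simpa using h))) (by fun_prop)
        have h2 : Continuous fun w : ℂ => (Y.strip i).θ (w - q).im :=
          (Y.strip i).contDiff_θ.continuous.comp (continuous_im.comp (by fun_prop))
        exact h2.continuousAt.sub (continuousAt_const.mul h1)
      refine hc.congr ?_
      filter_upwards [continuousAt_const.eventually_lt continuous_re.continuousAt h] with v hv
      rw [if_pos hv]
  · have hne : w - q ≠ 0 := by
      intro h0
      have := (hw i).1
      rw [← hq, h0, norm_zero] at this
      linarith [Y.δ_pos, Y.δ_lt i]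
    rw [stripFrame]
    split_ifs with h
    · simp only [if_pos (show q.re < w.re from h)]
      rw [div_norm_eq_exp_arg hne, ← exp_int_mul, ← exp_add]
      congr 1
      push_cast
      ring
    · have h1 : (w - q) / ‖w - q‖ = exp ((arg (-(w - q)) - Real.pi) * I) := by
        rw [sub_mul, exp_sub, exp_pi_mul_I, ← div_norm_eq_exp_arg (neg_ne_zero.2 hne), norm_neg]
        ring
      simp only [if_neg (show ¬ q.re < w.re from h)]
      rw [h1, ← exp_int_mul, ← exp_add, hleft, eq_comm, Complex.exp_eq_one_iff]
      refine ⟨0, ?_⟩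
      push_cast
      ring

end StripSystem

/-! ### Turning numbers and angles -/

theorem Complex.mul_ofReal_mem_slitPlane {z : ℂ} (hz : z ∈ slitPlane) {R : ℝ} (hR : 0 < R) :
    z * R ∈ slitPlane := by
  rw [mem_slitPlane_iff] at hz ⊢
  simpa [hR, hR.ne'] using hz

/-- An upper triangular real matrix with positive diagonal has no negative eigenvalue, so it never
reverses the direction of a vector. -/
theorem Complex.upperTriangular_div_mem_slitPlane {l κ ν : ℝ} (hl : 0 < l) (hν : 0 < ν) {ζ : ℂ}
    (hζ : ζ ≠ 0) : ((l * ζ.re + κ * ζ.im : ℝ) + (ν * ζ.im : ℝ) * I) / ζ ∈ slitPlane := by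
  by_contra h
  rw [mem_slitPlane_iff, not_or, not_lt, not_not] at h
  set q := ((l * ζ.re + κ * ζ.im : ℝ) + (ν * ζ.im : ℝ) * I) / ζ with hq
  have hmul : ((l * ζ.re + κ * ζ.im : ℝ) + (ν * ζ.im : ℝ) * I) = q * ζ := by
    rw [hq, div_mul_cancel₀ _ hζ]
  have hre := congrArg Complex.re hmul
  have him := congrArg Complex.im hmul
  simp [h.2] at hre him
  have h1 : ζ.im = 0 := him.resolve_left (by linarith [h.1])
  have h2 : ζ.re = 0 := by
    have h3 : (l - q.re) * ζ.re = 0 := by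
      rw [h1] at hre
      linarith
    exact (mul_eq_zero.1 h3).resolve_left (by linarith [h.1])
  exact hζ (Complex.ext h2 h1)

/-- The turning number may be computed with any angle function that is never opposite to the
velocity. -/
theorem HasTurningNumber.of_slitPlane {c : ℝ → ℂ} {t : ℤ} {ψ : ℝ → ℝ} (hc : ContDiff ℝ ∞ c)
    (hper : Function.Periodic c (2 * Real.pi)) (hψ : Continuous ψ)
    (hψt : ψ (2 * Real.pi) - ψ 0 = 2 * Real.pi * t)
    (hslit : ∀ s, deriv c s * exp (-(ψ s * I)) ∈ slitPlane) : HasTurningNumber c t := by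
  have hd : Continuous (deriv c) := hc.continuous_deriv (by simp)
  refine ⟨hc, hper, fun s h => ?_, fun s => ψ s + arg (deriv c s * exp (-(ψ s * I))), ?_, ?_, ?_⟩
  · exact slitPlane_ne_zero (hslit s) (by rw [h, zero_mul])
  · refine hψ.add (continuous_iff_continuousAt.2 fun s => ?_)
    exact ContinuousAt.comp (f := fun s => deriv c s * exp (-(ψ s * I)))
      (continuousAt_arg (hslit s)) (Continuous.continuousAt (by fun_prop))
  · intro s
    have h1 := norm_mul_exp_arg_mul_I (deriv c s * exp (-(ψ s * I)))
    have h2 : ‖deriv c s * exp (-(ψ s * I))‖ = ‖deriv c s‖ := by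
      rw [norm_mul, ← neg_mul, ← ofReal_neg, norm_exp_ofReal_mul_I, mul_one]
    rw [h2] at h1
    rw [ofReal_add, add_mul, exp_add, mul_left_comm, h1, mul_left_comm, ← exp_add]
    simp
  · have h1 : deriv c (2 * Real.pi) = deriv c 0 := by
      have := deriv_comp_add_const c (2 * Real.pi) 0
      rw [zero_add] at this
      rw [← this]
      congr 1
      exact funext hper
    have h2 : exp (-(ψ (2 * Real.pi) * I)) = exp (-(ψ 0 * I)) := by
      rw [Complex.exp_eq_exp_iff_exists_int]
      refine ⟨-t, ?_⟩
      rw [show ψ (2 * Real.pi) = ψ 0 + 2 * Real.pi * t by linarith]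
      push_cast
      ring
    simp only [h1, h2]
    linarith

/-- The direction from a point inside a circle winds once around. -/
theorem Complex.exists_angle_of_inside {p q : ℂ} {R : ℝ} (h : ‖p - q‖ < R) (τ : ℤ) :
    ∃ φ : ℝ → ℝ, Continuous φ ∧ φ (2 * Real.pi) - φ 0 = 2 * Real.pi * τ ∧ ∀ s : ℝ,
      (p + R * exp ((τ * s : ℝ) * I) - q) / ‖p + R * exp ((τ * s : ℝ) * I) - q‖ =
        exp (φ s * I) := by
  have hR : 0 < R := (norm_nonneg _).trans_lt h
  have hRc : (R : ℂ) ≠ 0 := ofReal_ne_zero.2 hR.ne'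
  set g : ℝ → ℂ := fun s => 1 + (p - q) / R * exp ((-(τ * s) : ℝ) * I) with hg
  have hgs : ∀ s, g s ∈ slitPlane := by
    intro s
    apply mem_slitPlane_of_norm_lt_one
    rw [norm_mul, norm_exp_ofReal_mul_I, mul_one, norm_div, norm_real, Real.norm_eq_abs,
      abs_of_pos hR, div_lt_one hR]
    exact h
  have hgc : Continuous g := by fun_prop
  have harg : Continuous fun s => arg (g s) := continuous_iff_continuousAt.2 fun s =>
    ContinuousAt.comp (f := g) (continuousAt_arg (hgs s)) hgc.continuousAt
  refine ⟨fun s => τ * s + arg (g s), by fun_prop, ?_, fun s => ?_⟩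
  · have : g (2 * Real.pi) = g 0 := by
      simp only [hg]
      congr 2
      rw [Complex.exp_eq_exp_iff_exists_int]
      exact ⟨-τ, by push_cast; ring⟩
    simp only [this]
    ring
  · have h1 : p + R * exp ((τ * s : ℝ) * I) - q = R * (exp ((τ * s : ℝ) * I) * g s) := by
      have h2 : exp ((τ * s : ℝ) * I) * exp ((-(τ * s) : ℝ) * I) = 1 := by
        rw [← exp_add]
        simp
      have h3 : (R : ℂ) * ((p - q) / R) = p - q := by field_simp
      simp only [hg]
      linear_combination (-(R * ((p - q) / R)) : ℂ) * h2 - h3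
    rw [h1, norm_mul, norm_mul, norm_exp_ofReal_mul_I, norm_real, Real.norm_eq_abs, abs_of_pos hR,
      one_mul, ofReal_mul R, mul_div_mul_left _ _ hRc, mul_div_assoc,
      div_norm_eq_exp_arg (slitPlane_ne_zero (hgs s)), ← exp_add]
    congr 1
    push_cast
    ring

/-- The direction from a point outside a circle does not wind. -/
theorem Complex.exists_angle_of_outside {p q : ℂ} {R : ℝ} (hR : 0 < R) (h : R < ‖p - q‖) (τ : ℤ) :
    ∃ φ : ℝ → ℝ, Continuous φ ∧ φ (2 * Real.pi) - φ 0 = 0 ∧ ∀ s : ℝ,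
      (p + R * exp ((τ * s : ℝ) * I) - q) / ‖p + R * exp ((τ * s : ℝ) * I) - q‖ =
        exp (φ s * I) := by
  have hpq0 : 0 < ‖p - q‖ := hR.trans h
  have hpq : p - q ≠ 0 := norm_pos_iff.1 hpq0
  set g : ℝ → ℂ := fun s => 1 + R / (p - q) * exp ((τ * s : ℝ) * I) with hg
  have hgs : ∀ s, g s ∈ slitPlane := by
    intro s
    apply mem_slitPlane_of_norm_lt_one
    rw [norm_mul, norm_exp_ofReal_mul_I, mul_one, norm_div, norm_real, Real.norm_eq_abs,
      abs_of_pos hR, div_lt_one hpq0]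
    exact h
  have hgc : Continuous g := by fun_prop
  have harg : Continuous fun s => arg (g s) := continuous_iff_continuousAt.2 fun s =>
    ContinuousAt.comp (f := g) (continuousAt_arg (hgs s)) hgc.continuousAt
  refine ⟨fun s => arg (p - q) + arg (g s), by fun_prop, ?_, fun s => ?_⟩
  · have : g (2 * Real.pi) = g 0 := by
      simp only [hg]
      congr 2
      rw [Complex.exp_eq_exp_iff_exists_int]
      exact ⟨τ, by push_cast; ring⟩
    simp only [this]
    ring
  · have h1 : p + R * exp ((τ * s : ℝ) * I) - q = (p - q) * g s := by
      simp only [hg]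
      field_simp
      ring
    rw [h1, norm_mul, ofReal_mul, mul_div_mul_comm, div_norm_eq_exp_arg hpq,
      div_norm_eq_exp_arg (slitPlane_ne_zero (hgs s)), ← exp_add]
    congr 1
    push_cast
    ring

theorem ContinuousLinearMap.det_complex (L : ℂ →L[ℝ] ℂ) :
    L.det = (L 1).re * (L I).im - (L I).re * (L 1).im := by
  rw [ContinuousLinearMap.det, ← LinearMap.det_toMatrix basisOneI, Matrix.det_fin_two]
  simp [LinearMap.toMatrix_apply]

/-! ### Discs with holes -/

namespace HoledDisc

variable {n : ℕ} (D : HoledDisc n)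

theorem mem_surface_iff {z : ℂ} : z ∈ D.surface ↔ ‖z - D.center 0‖ ≤ D.radius 0 ∧
    ∀ i : Fin n, D.radius i.succ ≤ ‖z - D.center i.succ‖ := by
  simp [surface, dist_eq]

theorem isCompact_surface : IsCompact D.surface :=
  (isCompact_closedBall _ _).diff (isOpen_iUnion fun _ => Metric.isOpen_ball)

theorem norm_center_sub_lt (i : Fin n) : ‖D.center 0 - D.center i.succ‖ < D.radius 0 := by
  have := D.hole_subset i (Metric.mem_closedBall_self (D.radius_pos _).le)
  rwa [Metric.mem_ball, dist_eq, norm_sub_rev] at this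

theorem radius_lt_norm_center_sub {i j : Fin n} (hij : i ≠ j) :
    D.radius i.succ < ‖D.center i.succ - D.center j.succ‖ := by
  by_contra! h
  refine Set.disjoint_left.1 (D.hole_disjoint i j hij) (?_ : D.center j.succ ∈ _)
    (Metric.mem_closedBall_self (D.radius_pos _).le)
  rwa [Metric.mem_closedBall, dist_eq, norm_sub_rev]

theorem center_injective : Function.Injective fun i : Fin n => D.center i.succ := by
  intro i j hij
  by_contra h
  have h1 := D.radius_lt_norm_center_sub h
  simp only at hij
  rw [hij, sub_self, norm_zero] at h1
  exact absurd (D.radius_pos i.succ) (not_lt.2 h1.le)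

/-- The sense of rotation of the `j`-th boundary circle. -/
def boundarySign (j : Fin (n + 1)) : ℤ := if j = 0 then 1 else -1

theorem boundaryCurve_one (j : Fin (n + 1)) (s : ℝ) : D.boundaryCurve 1 j s =
    D.center j + D.radius j * exp (((boundarySign j : ℤ) * s : ℝ) * I) := by
  rw [boundaryCurve, boundarySign]
  split_ifs <;> simp

theorem norm_boundaryCurve_sub (j : Fin (n + 1)) (s : ℝ) :
    ‖D.boundaryCurve 1 j s - D.center j‖ = D.radius j := by
  rw [boundaryCurve_one, add_sub_cancel_left, norm_mul, norm_exp_ofReal_mul_I, norm_real,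
    Real.norm_eq_abs, abs_of_pos (D.radius_pos j), mul_one]

theorem boundaryCurve_mem_surface (j : Fin (n + 1)) (s : ℝ) :
    D.boundaryCurve 1 j s ∈ D.surface := by
  set z := D.boundaryCurve 1 j s
  have hzj : ‖z - D.center j‖ = D.radius j := D.norm_boundaryCurve_sub j s
  rw [mem_surface_iff]
  refine Fin.cases (motive := fun j => ‖z - D.center j‖ = D.radius j → _) ?_ ?_ j hzj
  · refine fun h => ⟨h.le, fun i => ?_⟩
    by_contra! hi
    have h2 := D.hole_subset i (a := z) (by rw [Metric.mem_closedBall, dist_eq]; exact hi.le)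
    rw [Metric.mem_ball, dist_eq, h] at h2
    exact lt_irrefl _ h2
  · intro i h
    have hmem : z ∈ Metric.closedBall (D.center i.succ) (D.radius i.succ) := by
      rw [Metric.mem_closedBall, dist_eq, h]
    refine ⟨?_, fun k => ?_⟩
    · have h2 := D.hole_subset i hmem
      rw [Metric.mem_ball, dist_eq] at h2
      exact h2.le
    · rcases eq_or_ne i k with rfl | hik
      · exact h.ge
      · by_contra! hk
        refine Set.disjoint_left.1 (D.hole_disjoint i k hik) hmem ?_
        rw [Metric.mem_closedBall, dist_eq]
        exact hk.le

theorem hasDerivAt_boundaryCurve (j : Fin (n + 1)) (s : ℝ) :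
    HasDerivAt (D.boundaryCurve 1 j)
      (D.radius j * (exp (((boundarySign j : ℤ) * s : ℝ) * I) * ((boundarySign j : ℤ) * I))) s := by
  have h1 : HasDerivAt (fun s : ℝ => ((((boundarySign j : ℤ) * s : ℝ) : ℂ) * I))
      ((boundarySign j : ℤ) * I) s := by
    have h2 : HasDerivAt (fun s : ℝ => ((boundarySign j : ℤ) * s : ℝ)) (boundarySign j : ℤ) s := by
      simpa using (hasDerivAt_id s).const_mul ((boundarySign j : ℤ) : ℝ)
    simpa using h2.ofReal_comp.mul_const I
  rw [show D.boundaryCurve 1 j = _ from funext (D.boundaryCurve_one j)]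
  exact (h1.cexp.const_mul _).const_add _

theorem contDiff_boundaryCurve (j : Fin (n + 1)) : ContDiff ℝ ∞ (D.boundaryCurve 1 j) := by
  have hof : ContDiff ℝ ∞ (fun x : ℝ => (x : ℂ)) := ofRealCLM.contDiff
  rw [show D.boundaryCurve 1 j = _ from funext (D.boundaryCurve_one j)]
  exact contDiff_const.add (contDiff_const.mul
    ((hof.comp (contDiff_const.mul contDiff_id)).mul contDiff_const).cexp)

theorem periodic_boundaryCurve (j : Fin (n + 1)) :
    Function.Periodic (D.boundaryCurve 1 j) (2 * Real.pi) := by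
  intro s
  rw [boundaryCurve_one, boundaryCurve_one]
  congr 2
  rw [Complex.exp_eq_exp_iff_exists_int]
  exact ⟨boundarySign j, by push_cast; ring⟩

/-- The direction from the centre of the `i`-th hole winds once around along the outer circle and
along the boundary of that hole, and does not wind along the other circles. -/
theorem exists_angle (j : Fin (n + 1)) (i : Fin n) : ∃ φ : ℝ → ℝ, Continuous φ ∧
    φ (2 * Real.pi) - φ 0 =
      2 * Real.pi * ((boundarySign j * if j = 0 ∨ j = i.succ then 1 else 0 : ℤ) : ℝ) ∧
    ∀ s, (D.boundaryCurve 1 j s - D.center i.succ) / ‖D.boundaryCurve 1 j s - D.center i.succ‖ =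
      exp (φ s * I) := by
  simp only [boundaryCurve_one]
  split_ifs with h
  · rw [mul_one]
    refine exists_angle_of_inside ?_ _
    rcases h with rfl | rfl
    · exact D.norm_center_sub_lt i
    · rw [sub_self, norm_zero]
      exact D.radius_pos _
  · rw [not_or] at h
    obtain ⟨k, rfl⟩ := Fin.exists_succ_eq.2 h.1
    simp only [mul_zero, Int.cast_zero]
    exact exists_angle_of_outside (D.radius_pos _)
      (D.radius_lt_norm_center_sub fun hki => h.2 (by rw [hki])) _

/-- Each point of the surface lies in a round disc contained in the surface. -/
theorem uniqueDiffWithinAt_surface {z : ℂ} (hz : z ∈ D.surface) :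
    UniqueDiffWithinAt ℝ D.surface z := by
  obtain ⟨h0, hi⟩ := D.mem_surface_iff.1 hz
  have hout : ∀ i : Fin n, D.radius i.succ < ‖z - D.center i.succ‖ →
      ∀ᶠ v in nhds z, D.radius i.succ ≤ ‖v - D.center i.succ‖ := by
    intro i h
    have hc : Continuous fun v => ‖v - D.center i.succ‖ := by fun_prop
    exact (continuousAt_const.eventually_lt hc.continuousAt h).mono fun v hv => hv.le
  have hin : ‖z - D.center 0‖ < D.radius 0 → ∀ᶠ v in nhds z, ‖v - D.center 0‖ ≤ D.radius 0 := by
    intro h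
    have hc : Continuous fun v => ‖v - D.center 0‖ := by fun_prop
    exact (hc.continuousAt.eventually_lt continuousAt_const h).mono fun v hv => hv.le
  have hconvex : ∀ (q : ℂ) (R : ℝ), 0 < R → z ∈ Metric.closedBall q R →
      UniqueDiffWithinAt ℝ (Metric.closedBall q R) z := by
    intro q R hR hzq
    refine uniqueDiffWithinAt_convex (convex_closedBall q R) ?_ (subset_closure hzq)
    exact ⟨q, Metric.ball_subset_interior_closedBall (Metric.mem_ball_self hR)⟩
  by_cases hb : ∃ i : Fin n, ‖z - D.center i.succ‖ = D.radius i.succ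
  · obtain ⟨i, hzi⟩ := hb
    have hri := D.radius_pos i.succ
    -- Reflecting the disc of the hole in the point `z` gives a disc tangent to the hole.
    have htan : UniqueDiffWithinAt ℝ
        (Metric.closedBall (z + (z - D.center i.succ)) (D.radius i.succ)) z := by
      refine hconvex _ _ hri ?_
      rw [Metric.mem_closedBall, dist_eq, ← hzi, ← norm_neg]
      exact le_of_eq (congrArg _ (by ring))
    have hmem : z ∈ Metric.closedBall (D.center i.succ) (D.radius i.succ) := by
      rw [Metric.mem_closedBall, dist_eq, hzi]
    have hothers : ∀ k : Fin n, ∀ᶠ v in nhds z, k = i ∨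
        D.radius k.succ ≤ ‖v - D.center k.succ‖ := by
      intro k
      rcases eq_or_ne k i with hk | hk
      · exact Filter.Eventually.of_forall fun _ => Or.inl hk
      · refine (hout k ?_).mono fun _ => Or.inr
        by_contra! hle
        refine Set.disjoint_left.1 (D.hole_disjoint k i hk) ?_ hmem
        rwa [Metric.mem_closedBall, dist_eq]
    have hz0 := D.hole_subset i hmem
    rw [Metric.mem_ball, dist_eq] at hz0
    refine (htan.inter ((hin hz0).and (Filter.eventually_all.2 hothers))).mono ?_
    rintro v ⟨hv, hv0, hvk⟩
    refine D.mem_surface_iff.2 ⟨hv0, fun k => ?_⟩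
    rcases hvk k with rfl | h
    · rw [Metric.mem_closedBall, dist_eq] at hv
      have h1 : (2 : ℂ) * (z - D.center k.succ) =
          (v - D.center k.succ) - (v - (z + (z - D.center k.succ))) := by ring
      have h2 := norm_sub_le (v - D.center k.succ) (v - (z + (z - D.center k.succ)))
      rw [← h1, norm_mul, hzi, Complex.norm_two] at h2
      linarith
    · exact h
  · push Not at hb
    have hzball : z ∈ Metric.closedBall (D.center 0) (D.radius 0) := by
      rwa [Metric.mem_closedBall, dist_eq]
    have hall := Filter.eventually_all.2 fun i =>
      hout i (lt_of_le_of_ne (hi i) (Ne.symm (hb i)))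
    refine ((hconvex _ _ (D.radius_pos 0) hzball).inter hall).mono ?_
    rintro v ⟨hv, hvk⟩
    rw [Metric.mem_closedBall, dist_eq] at hv
    exact D.mem_surface_iff.2 ⟨hv, hvk⟩

end HoledDisc

/-! ### The realization -/

/-- A rotation and dilation brings finitely many distinct points to distinct heights. -/
theorem exists_mul_im_injective {n : ℕ} {c : Fin n → ℂ} (hc : Function.Injective c) :
    ∃ a : ℂ, a ≠ 0 ∧ ∀ i j, i ≠ j → (a * c i).im ≠ (a * c j).im := by
  -- With `a = 1 - t I`, each pair of points excludes at most one value of `t`.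
  obtain ⟨t, ht⟩ := (Set.finite_range fun q : Fin n × Fin n =>
    (c q.1 - c q.2).im / (c q.1 - c q.2).re).exists_notMem
  refine ⟨⟨1, -t⟩, fun h => by simpa using congrArg Complex.re h, fun i j hij h => ht ⟨(i, j), ?_⟩⟩
  have h1 : (c i - c j).im = t * (c i - c j).re := by
    simp at h ⊢
    linarith
  have h2 : (c i - c j).re ≠ 0 := by
    intro h0
    rw [h0, mul_zero] at h1
    exact hij (hc (sub_eq_zero.1 (Complex.ext h0 h1)))
  simp only
  rw [div_eq_iff h2, h1]

theorem StripSystem.exists_of_im_injective {n : ℕ} (b : Fin n → ℤ) (p : Fin n → ℂ)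
    (r : Fin n → ℝ) {X : ℝ} (hr : ∀ i, 0 < r i) (hX : 0 < X)
    (hp : ∀ i j, i ≠ j → (p i).im ≠ (p j).im) :
    ∃ Y : StripSystem n, Y.b = b ∧ Y.p = p ∧ Y.r = r ∧ Y.X = X := by
  choose δ₀ hδ₀ hT using fun i => StripTwist.exists_nonempty (b i) (hr i) hX
  have hsmall : ∀ x : ℝ, 0 < x → ∀ᶠ δ in nhdsWithin (0 : ℝ) (Set.Ioi 0), δ < x := fun x hx =>
    mem_nhdsWithin_of_mem_nhds (Iio_mem_nhds hx)
  have h1 := Filter.eventually_all.2 fun i => hsmall (δ₀ i) (hδ₀ i)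
  have h2 := Filter.eventually_all.2 fun i => hsmall (r i) (hr i)
  have h3 : ∀ᶠ δ in nhdsWithin (0 : ℝ) (Set.Ioi 0), ∀ i j, i ≠ j →
      4 * δ < |(p i).im - (p j).im| := by
    simp only [Filter.eventually_all]
    intro i j hij
    have hpos : 0 < |(p i).im - (p j).im| := abs_pos.2 (sub_ne_zero.2 (hp i j hij))
    filter_upwards [hsmall (|(p i).im - (p j).im| / 4) (by positivity)] with δ hδ
    linarith
  obtain ⟨δ, hδ1, hδ2, hδ3, hδ0⟩ := (h1.and (h2.and (h3.and self_mem_nhdsWithin))).exists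
  exact ⟨⟨b, p, r, X, δ, hδ0, hδ2, hδ3, fun i => (hT i δ hδ0 (hδ1 i)).some⟩, rfl, rfl, rfl, rfl⟩

open HoledDisc in
/-- A disc with holes has an embedding into `ℝ² × ℝ` with any prescribed numbers `b i` of turns
about the holes. -/
theorem HoledDisc.exists_realization {n : ℕ} (D : HoledDisc n) (b : Fin n → ℤ) :
    ∃ ε : ℂ → ℂ × ℝ, IsSmoothEmbeddingOn ε D.surface ∧
      (∀ x ∈ interior D.surface, Function.Surjective (fderiv ℝ (planeProj ε) x)) ∧
      ∀ j, HasBoundaryTurningNumber D ε j (boundarySign j *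
        (1 + ∑ i, b i * if j = 0 ∨ j = i.succ then 1 else 0)) := by
  obtain ⟨a, ha, hinj⟩ := exists_mul_im_injective D.center_injective
  have ha' : 0 < ‖a‖ := norm_pos_iff.2 ha
  have hR := D.radius_pos 0
  obtain ⟨Y, hYb, hYp, hYr, hYX⟩ := StripSystem.exists_of_im_injective b
    (fun i => a * D.center i.succ) (fun i => ‖a‖ * D.radius i.succ)
    (X := ‖a‖ * (2 * D.radius 0)) (fun i => mul_pos ha' (D.radius_pos _)) (by positivity) hinj
  have hYp' : ∀ z i, a * z - Y.p i = a * (z - D.center i.succ) := by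
    intro z i
    rw [hYp]
    ring
  have hregion : ∀ z ∈ D.surface, a * z ∈ Y.region := by
    intro z hz i
    obtain ⟨h0, hi⟩ := D.mem_surface_iff.1 hz
    rw [hYp', hYr, hYX, norm_mul]
    refine ⟨mul_le_mul_of_nonneg_left (hi i) ha'.le, mul_le_mul_of_nonneg_left ?_ ha'.le⟩
    have h1 := norm_add_le (z - D.center 0) (D.center 0 - D.center i.succ)
    rw [sub_add_sub_cancel] at h1
    linarith [D.norm_center_sub_lt i]
  set A : ℂ →L[ℝ] ℂ := ContinuousLinearMap.mul ℝ ℂ a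
  have hAd : ∀ z, HasFDerivAt (fun z : ℂ => a * z) A z := fun z => A.hasFDerivAt
  set f : ℂ → ℂ := fun z => Y.map (a * z) with hf
  have hfs : ∀ z ∈ D.surface, ContDiffAt ℝ ∞ f z := fun z hz =>
    (StripSystem.contDiffAt_map (hregion z hz)).comp z A.contDiff.contDiffAt
  -- The differential of `f` in triangular form.
  have hfd : ∀ z ∈ D.surface, ∃ L : ℂ →L[ℝ] ℂ, HasFDerivAt f L z ∧ ∃ l κ ν : ℝ, 0 < l ∧ 0 < ν ∧
      ∀ v, L v = Y.frame (a * z) *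
        ((l * (a * v).re + κ * (a * v).im : ℝ) + (ν * (a * v).im : ℝ) * I) := by
    intro z hz
    obtain ⟨L, hL, l, κ, ν, hl, hν, hLv⟩ := StripSystem.exists_hasFDerivAt_map (hregion z hz)
    exact ⟨L.comp A, hL.comp z (hAd z), l, κ, ν, hl, hν, fun v => hLv (a * v)⟩
  -- The frame along the boundary circles.
  choose Λ hΛc hΛ using fun i => StripSystem.exists_stripFrame_eq (Y := Y) i
  choose φ hφc hφt hφ using D.exists_angle
  have hframe : ∀ j s, Y.frame (a * D.boundaryCurve 1 j s) =
      exp ((∑ i, (Λ i (a * D.boundaryCurve 1 j s) + b i * (arg a + φ j i s)) : ℝ) * I) := by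
    intro j s
    rw [StripSystem.frame, ofReal_sum, Finset.sum_mul, Complex.exp_sum]
    refine Finset.prod_congr rfl fun i _ => ?_
    rw [hΛ i _ (hregion _ (D.boundaryCurve_mem_surface j s)), hYp', norm_mul, ofReal_mul,
      mul_div_mul_comm, div_norm_eq_exp_arg ha, hφ, ← exp_add, ← exp_int_mul, ← exp_add, hYb]
    congr 1
    push_cast
    ring
  have hframe0 : ∀ z ∈ D.surface, Y.frame (a * z) ≠ 0 := by
    intro z hz
    refine Finset.prod_ne_zero_iff.2 fun i _ => ?_
    rw [StripSystem.stripFrame]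
    split_ifs
    · exact exp_ne_zero _
    · exact one_ne_zero
  have hdet : ∀ z ∈ D.surface, 0 < (fderiv ℝ f z).det := by
    intro z hz
    obtain ⟨L, hL, l, κ, ν, hl, hν, hLv⟩ := hfd z hz
    rw [hL.fderiv, ContinuousLinearMap.det_complex, hLv, hLv]
    have h1 : 0 < normSq (Y.frame (a * z)) := normSq_pos.2 (hframe0 z hz)
    have h2 : 0 < normSq a := normSq_pos.2 ha
    have h3 : 0 < normSq (Y.frame (a * z)) * normSq a * (l * ν) := by positivity
    refine lt_of_lt_of_eq h3 ?_
    simp [normSq_apply]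
    ring
  have hbij : ∀ z ∈ D.surface, Function.Bijective (fderiv ℝ f z) := by
    intro z hz
    have h1 : LinearMap.det (fderiv ℝ f z : ℂ →ₗ[ℝ] ℂ) ≠ 0 := (hdet z hz).ne'
    exact (LinearMap.equivOfDetNeZero _ h1).bijective
  refine ⟨fun z => (f z, (a * z).im), ⟨?_, ?_, ?_⟩, fun x hx => (hbij x (interior_subset hx)).2,
    fun j => ⟨1, Or.inl rfl, fun x hx => ?_, ?_⟩⟩
  · exact fun z hz => ((hfs z hz).prodMk
      (imCLM.contDiff.comp A.contDiff).contDiffAt).contDiffWithinAt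
  · have hcont : Continuous (D.surface.domRestrict fun z => (f z, (a * z).im)) := by
      rw [← continuousOn_iff_continuous_domRestrict]
      refine ContinuousOn.prodMk (fun z hz => (hfs z hz).continuousAt.continuousWithinAt) ?_
      exact (continuous_im.comp (continuous_const.mul continuous_id)).continuousOn
    have := isCompact_iff_compactSpace.1 D.isCompact_surface
    refine (hcont.isClosedEmbedding ?_).isEmbedding
    rintro ⟨z, hz⟩ ⟨z', hz'⟩ h
    have h' := Prod.ext_iff.1 h
    have h1 := StripSystem.eq_of_map_eq (hregion z hz) (hregion z' hz') h'.2 h'.1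
    exact Subtype.ext (mul_left_cancel₀ ha h1)
  · intro z hz
    have h1 : HasFDerivAt (fun z => (f z, (a * z).im)) ((fderiv ℝ f z).prod (imCLM.comp A)) z :=
      ((hfs z hz).differentiableAt (by simp)).hasFDerivAt.prodMk (imCLM.hasFDerivAt.comp z (hAd z))
    rw [h1.hasFDerivWithinAt.fderivWithin (D.uniqueDiffWithinAt_surface hz)]
    intro v v' h
    exact (hbij z hz).1 (Prod.ext_iff.1 h).1
  · rw [one_mul]
    exact hdet x (interior_subset hx)
  · have hmem := D.boundaryCurve_mem_surface j
    have hτ : ((boundarySign j : ℤ) : ℂ) * I ≠ 0 := by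
      refine mul_ne_zero (Int.cast_ne_zero.2 ?_) I_ne_zero
      rw [boundarySign]
      split_ifs <;> norm_num
    have hτn : ‖((boundarySign j : ℤ) : ℂ) * I‖ = 1 := by
      rw [boundarySign]
      split_ifs <;> simp
    have hτarg : ((boundarySign j : ℤ) : ℂ) * I = exp (arg ((boundarySign j : ℤ) * I) * I) := by
      rw [← div_norm_eq_exp_arg hτ, hτn, ofReal_one, div_one]
    -- The angle of the frame plus the angle of `a` times the velocity of the boundary circle.
    refine HasTurningNumber.of_slitPlane
      (ψ := fun s => (∑ i, (Λ i (a * D.boundaryCurve 1 j s) + b i * (arg a + φ j i s))) +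
        (arg a + boundarySign j * s + arg ((boundarySign j : ℤ) * I))) ?_ ?_ ?_ ?_ ?_
    · exact contDiff_iff_contDiffAt.2 fun s =>
        (hfs _ (hmem s)).comp s (D.contDiff_boundaryCurve j).contDiffAt
    · intro s
      change f (D.boundaryCurve 1 j (s + _)) = f (D.boundaryCurve 1 j s)
      rw [D.periodic_boundaryCurve j s]
    · refine Continuous.add (continuous_finsetSum _ fun i _ => Continuous.add ?_ ?_) (by fun_prop)
      · exact (hΛc i).comp_continuous
          (continuous_const.mul (D.contDiff_boundaryCurve j).continuous)
          fun s => hregion _ (hmem s)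
      · exact continuous_const.mul (continuous_const.add (hφc j i))
    · have hper : D.boundaryCurve 1 j (2 * Real.pi) = D.boundaryCurve 1 j 0 := by
        simpa using D.periodic_boundaryCurve j 0
      have hsum : ∀ i, b i * φ j i (2 * Real.pi) = b i * φ j i 0 + b i * (2 * Real.pi *
          ((boundarySign j * if j = 0 ∨ j = i.succ then 1 else 0 : ℤ) : ℝ)) := by
        intro i
        rw [← hφt]
        ring
      simp only [hper, mul_add, hsum, Finset.sum_add_distrib]
      push_cast
      rw [Finset.mul_sum, mul_add, Finset.mul_sum]
      have : ∀ i, (b i : ℝ) * (2 * Real.pi * (boundarySign j *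
          if j = 0 ∨ j = i.succ then 1 else 0)) = 2 * Real.pi * (boundarySign j *
          (b i * if j = 0 ∨ j = i.succ then 1 else 0)) := fun i => by ring
      simp only [this]
      ring
    · intro s
      obtain ⟨L, hL, l, κ, ν, hl, hν, hLv⟩ := hfd _ (hmem s)
      have hderiv : deriv (fun s => planeProj (fun z => (f z, (a * z).im)) (D.boundaryCurve 1 j s))
          s = L (D.radius j * (exp (((boundarySign j : ℤ) * s : ℝ) * I) *
            ((boundarySign j : ℤ) * I))) :=
        (hL.comp_hasDerivAt s (D.hasDerivAt_boundaryCurve j s)).deriv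
      have hζ : a * (D.radius j * (exp (((boundarySign j : ℤ) * s : ℝ) * I) *
          ((boundarySign j : ℤ) * I))) = (‖a‖ * D.radius j : ℝ) *
          exp ((arg a + boundarySign j * s + arg ((boundarySign j : ℤ) * I) : ℝ) * I) := by
        rw [ofReal_add (_ + _), add_mul _ _ I, exp_add, ← hτarg, ofReal_add, add_mul _ _ I, exp_add,
          ofReal_mul ‖a‖]
        nth_rewrite 1 [← norm_mul_exp_arg_mul_I a]
        ring
      have hR' : 0 < ‖a‖ * D.radius j := mul_pos ha' (D.radius_pos j)
      have hζ0 : a * (D.radius j * (exp (((boundarySign j : ℤ) * s : ℝ) * I) *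
          ((boundarySign j : ℤ) * I))) ≠ 0 := by
        rw [hζ]
        exact mul_ne_zero (ofReal_ne_zero.2 hR'.ne') (exp_ne_zero _)
      have hQ := mul_ofReal_mem_slitPlane
        (upperTriangular_div_mem_slitPlane (κ := κ) hl hν hζ0) hR'
      rw [hderiv, hLv, hframe]
      convert hQ using 1
      have hsplit : ∀ x y : ℝ, exp (-((x + y : ℝ) * I)) = (exp (x * I))⁻¹ * (exp (y * I))⁻¹ := by
        intro x y
        rw [ofReal_add, add_mul, neg_add, exp_add, exp_neg, exp_neg]
      rw [hsplit, hζ]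
      have he1 := exp_ne_zero
        ((∑ i, (Λ i (a * D.boundaryCurve 1 j s) + b i * (arg a + φ j i s)) : ℝ) * I)
      have he2 := exp_ne_zero
        ((arg a + boundarySign j * s + arg ((boundarySign j : ℤ) * I) : ℝ) * I)
      have he3 : ((‖a‖ * D.radius j : ℝ) : ℂ) ≠ 0 := ofReal_ne_zero.2 hR'.ne'
      generalize exp ((∑ i, (Λ i (a * D.boundaryCurve 1 j s) + b i * (arg a + φ j i s)) : ℝ) * I) =
        e1 at *
      generalize exp ((arg a + boundarySign j * s + arg ((boundarySign j : ℤ) * I) : ℝ) * I) =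
        e2 at *
      generalize ((‖a‖ * D.radius j : ℝ) : ℂ) = e3 at *
      field_simp

/-- The permutation `γ` is an arbitrary labelling of the boundary curves of the surface. -/
theorem proposition5p2 (n : ℕ) (D : HoledDisc n) (γ : Equiv.Perm (Fin (n + 1)))
    (W k : Fin (n + 1) → ℤ) (hW : IsTurningWeight n W) (hk : IsWeightBasis n W k) :
    ∃ ε : ℂ → ℂ × ℝ, IsGeometricRealization D ε W ∧
      HasBoundaryTurningNumber D ε (γ 0) (1 + 2 * k 0) ∧
      ∀ i : Fin n, HasBoundaryTurningNumber D ε (γ i.succ) (-1 + 2 * k i.succ) := by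
  -- The weight of the `i`-th hole is `-(1 + b i)`; that of the outer circle is then determined.
  obtain ⟨ε, hemb, hreg, hturn⟩ := D.exists_realization fun i => -1 - W (γ.symm i.succ)
  have hsum : ∑ j, W (γ.symm j) = 1 - (n : ℤ) := by
    rw [Equiv.sum_comp γ.symm W, hW.sum_eq]
  rw [Fin.sum_univ_succ] at hsum
  have hall : ∀ j, HasBoundaryTurningNumber D ε j (W (γ.symm j)) := by
    intro j
    convert hturn j using 1
    refine Fin.cases ?_ (fun i => ?_) j
    · simp [HoledDisc.boundarySign]
      linarith
    · simp [HoledDisc.boundarySign, Fin.succ_ne_zero]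
  have hγ : ∀ i, HasBoundaryTurningNumber D ε (γ i) (W i) := by
    intro i
    simpa using hall (γ i)
  refine ⟨ε, ⟨hemb, hreg, γ, hγ⟩, hk.zero_eq ▸ hγ 0, fun i => hk.succ_eq i ▸ hγ i.succ⟩
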